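/- Let $\mathbb G$ be a small groupoid and write $\mathrm{PSh}(\mathbb G)=\mathbf{Set}^{\mathbb G^{\mathrm{op}}}$, with Yoneda embedding $y$. For a small category $\mathbb C$, let $!\mathbb C$ be the free symmetric strict monoidal completion of $\mathbb C$: its objects are finite sequences $A=(A_i)_{i<n}$ of objects of $\mathbb C$, and a morphism $A\to B$ is a bijection $\sigma$ from the index set of $A$ to that of $B$ together with morphisms $A_i\to B_{\sigma(i)}$ of $\mathbb C$ for all $i$. Let $S_{\mathbb C}:{!\mathbb C}\to\mathrm{PSh}(\mathbb C)$ be the sum functor $S_{\mathbb C}(A)=\sum_i y(A_i)$. A functor $F:\mathrm{PSh}(\mathbb A)\to\mathrm{PSh}(\mathbb B)$, with $\mathbb A,\mathbb B$ small categories, is called analytic if, for some functor $P:{!\mathbb A}\to\mathrm{PSh}(\mathbb B)$ and some natural transformation $P\Rightarrow F\circ S_{\mathbb A}$, it is a left Kan extension of $P$ along $S_{\mathbb A}$. Then every analytic endofunctor $F:\mathrm{PSh}(\mathbb G)\to\mathrm{PSh}(\mathbb G)$ has an initial algebra and a final coalgebra; that is, the category of $F$-algebras has an initial object and the category of $F$-coalgebras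 has a terminal object. -/

import Mathlib

open CategoryTheory

universe u

/-- Objects of the free symmetric strict monoidal completion of a category `C`:
finite sequences `Fin n → C` of objects of `C`. -/
structure FreeSMC (C : Type u) : Type u where
  /-- the length of the sequence -/
  card : ℕ
  /-- the entries of the sequence -/
  obj : Fin card → C

namespace FreeSMC

variable {C : Type u} [SmallCategory C]

/-- A morphism `A ⟶ B` is a bijection `σ` between the index sets together with a family of
morphisms `A i ⟶ B (σ i)` of `C`. -/
@[ext]
structure Hom (A B : FreeSMC C) : Type u where
  /-- the underlying bijection on indices -/
  perm : Fin A.card ≃ Fin B.card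
  /-- the component at each index -/
  comp : ∀ i, A.obj i ⟶ B.obj (perm i)

instance : SmallCategory (FreeSMC C) where
  Hom := Hom
  id A := ⟨Equiv.refl _, fun i => 𝟙 (A.obj i)⟩
  comp f g := ⟨f.perm.trans g.perm, fun i => f.comp i ≫ g.comp (f.perm i)⟩
  id_comp f := Hom.ext rfl (heq_of_eq (funext fun i => Category.id_comp (f.comp i)))
  comp_id f := Hom.ext rfl (heq_of_eq (funext fun i => Category.comp_id (f.comp i)))
  assoc f g h := Hom.ext rfl (heq_of_eq (funext fun i =>
    Category.assoc (f.comp i) (g.comp (f.perm i)) (h.comp (g.perm (f.perm i)))))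

/-- The sum functor, sending a sequence `A` to the coproduct `∑ i, y (A i)` of representable
presheaves (coproducts of presheaves being computed pointwise as disjoint unions). -/
def sum (C : Type u) [SmallCategory C] : FreeSMC C ⥤ (Cᵒᵖ ⥤ Type u) where
  obj A :=
    { obj c := Σ i : Fin A.card, (c.unop ⟶ A.obj i)
      map f := ↾fun x => ⟨x.1, f.unop ≫ x.2⟩
      map_id c := by
        refine ConcreteCategory.hom_ext _ _ fun ⟨i, g⟩ => ?_
        exact congrArg (Sigma.mk (β := fun i => c.unop ⟶ A.obj i) i) (Category.id_comp g)
      map_comp {c d e} f h := by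
        refine ConcreteCategory.hom_ext _ _ fun ⟨i, g⟩ => ?_
        exact congrArg (Sigma.mk (β := fun i => e.unop ⟶ A.obj i) i)
          (Category.assoc h.unop f.unop g) }
  map {A B} γ :=
    { app c := ↾fun x => ⟨γ.perm x.1, x.2 ≫ γ.comp x.1⟩
      naturality c d f := by
        refine ConcreteCategory.hom_ext _ _ fun ⟨i, g⟩ => ?_
        exact congrArg (Sigma.mk (β := fun j => d.unop ⟶ B.obj j) (γ.perm i))
          (Category.assoc f.unop g (γ.comp i)) }
  map_id A := by
    refine NatTrans.ext (funext fun c => ConcreteCategory.hom_ext _ _ fun ⟨i, g⟩ => ?_)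
    exact congrArg (Sigma.mk (β := fun i => c.unop ⟶ A.obj i) i) (Category.comp_id g)
  map_comp {A B D} γ δ := by
    refine NatTrans.ext (funext fun c => ConcreteCategory.hom_ext _ _ fun ⟨i, g⟩ => ?_)
    exact congrArg (Sigma.mk (β := fun j => c.unop ⟶ D.obj j) (δ.perm (γ.perm i)))
      (Category.assoc g (γ.comp i) (δ.comp (γ.perm i))).symm

end FreeSMC

/-- A functor `F : PSh(A) ⥤ PSh(B)` between presheaf categories over small categories is analytic
if, for some functor `P : FreeSMC A ⥤ PSh(B)` and some natural transformation
`η : P ⟶ sum A ⋙ F`, the pair `(F, η)` is a left Kan extension of `P` along the sum functor. -/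
def IsAnalytic {A B : Type u} [SmallCategory A] [SmallCategory B]
    (F : (Aᵒᵖ ⥤ Type u) ⥤ (Bᵒᵖ ⥤ Type u)) : Prop :=
  ∃ (P : FreeSMC A ⥤ (Bᵒᵖ ⥤ Type u)) (η : P ⟶ FreeSMC.sum A ⋙ F), F.IsLeftKanExtension η

namespace FreeSMC

variable {G : Type u}

theorem hom_ext_of_perm_eq {C : Type u} [SmallCategory C] {A B : FreeSMC C} {f g : A ⟶ B}
    (hp : ∀ i, f.perm i = g.perm i)
    (hc : ∀ i, f.comp i = g.comp i ≫ eqToHom (congrArg B.obj (hp i).symm)) : f = g := by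
  obtain ⟨σ, φ⟩ := f
  obtain ⟨τ, ψ⟩ := g
  obtain rfl : σ = τ := Equiv.ext hp
  congr 1
  funext i
  simpa using hc i

variable [SmallGroupoid G]

/-- The inverse of a morphism of sequences in a groupoid. -/
def inv {A B : FreeSMC G} (f : A ⟶ B) : B ⟶ A where
  perm := f.perm.symm
  comp i := eqToHom (congrArg B.obj (f.perm.apply_symm_apply i).symm) ≫
    Groupoid.inv (f.comp (f.perm.symm i))

theorem comp_inv {A B : FreeSMC G} (f : A ⟶ B) : f ≫ inv f = 𝟙 A := by
  refine hom_ext_of_perm_eq (fun i => f.perm.symm_apply_apply i) fun i => ?_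
  have key : ∀ (j : Fin A.card) (h : i = j),
      f.comp i ≫ eqToHom (congrArg (fun k => B.obj (f.perm k)) h) ≫ Groupoid.inv (f.comp j) =
        𝟙 _ ≫ eqToHom (congrArg A.obj h) := by
    rintro _ rfl
    simp
  exact key _ (f.perm.symm_apply_apply i).symm

theorem inv_comp {A B : FreeSMC G} (f : A ⟶ B) : inv f ≫ f = 𝟙 B := by
  refine hom_ext_of_perm_eq (fun i => f.perm.apply_symm_apply i) fun i => ?_
  change (eqToHom _ ≫ Groupoid.inv (f.comp (f.perm.symm i))) ≫ f.comp (f.perm.symm i) =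
    𝟙 _ ≫ eqToHom _
  simp

end FreeSMC

namespace IsAnalytic

open Limits Functor Opposite

section

variable {A B : Type u} [SmallCategory A] [SmallCategory B]
  {F : (Aᵒᵖ ⥤ Type u) ⥤ (Bᵒᵖ ⥤ Type u)} {P : FreeSMC A ⥤ (Bᵒᵖ ⥤ Type u)}
  (η : P ⟶ FreeSMC.sum A ⋙ F)

/-- The element of `F X` represented by a morphism `t` from a finite sum of representables to `X`
and an element of the coefficient presheaf. -/
def elem {X : Aᵒᵖ ⥤ Type u} {b : Bᵒᵖ} {a : FreeSMC A} (t : (FreeSMC.sum A).obj a ⟶ X)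
    (p : (P.obj a).obj b) : (F.obj X).obj b :=
  (F.map t).app b ((η.app a).app b p)

theorem map_elem {X Y : Aᵒᵖ ⥤ Type u} {b : Bᵒᵖ} {a : FreeSMC A}
    (t : (FreeSMC.sum A).obj a ⟶ X) (p : (P.obj a).obj b) (g : X ⟶ Y) :
    (F.map g).app b (elem η t p) = elem η (t ≫ g) p := by
  simp [elem]

theorem elem_map {X : Aᵒᵖ ⥤ Type u} {b : Bᵒᵖ} {a a' : FreeSMC A} (f : a ⟶ a')
    (t : (FreeSMC.sum A).obj a' ⟶ X) (p : (P.obj a).obj b) :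
    elem η t ((P.map f).app b p) = elem η ((FreeSMC.sum A).map f ≫ t) p := by
  have := ConcreteCategory.congr_hom (NatTrans.congr_app (η.naturality f) b) p
  simp only [NatTrans.comp_app, ConcreteCategory.comp_apply] at this
  simp [elem, this]

variable [F.IsLeftKanExtension η]

/-- The sections of a left Kan extension as a colimit of types. -/
noncomputable def isColimitSections (X : Aᵒᵖ ⥤ Type u) (b : Bᵒᵖ) :
    IsColimit (((evaluation _ _).obj b).mapCocone ((LeftExtension.mk F η).coconeAt X)) :=
  isColimitOfPreserves _ (isPointwiseLeftKanExtensionOfIsLeftKanExtension F η X)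

theorem exists_elem_eq {X : Aᵒᵖ ⥤ Type u} {b : Bᵒᵖ} (z : (F.obj X).obj b) :
    ∃ (a : FreeSMC A) (t : (FreeSMC.sum A).obj a ⟶ X) (p : (P.obj a).obj b), elem η t p = z := by
  obtain ⟨j, p, h⟩ := Types.jointly_surjective_of_isColimit (isColimitSections η X b) z
  refine ⟨j.left, j.hom, p, ?_⟩
  exact h

theorem eqvGen_of_elem_eq {X : Aᵒᵖ ⥤ Type u} {b : Bᵒᵖ} {a a' : FreeSMC A}
    {t : (FreeSMC.sum A).obj a ⟶ X} {t' : (FreeSMC.sum A).obj a' ⟶ X}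
    {p : (P.obj a).obj b} {p' : (P.obj a').obj b} (h : elem η t p = elem η t' p') :
    Relation.EqvGen (((CostructuredArrow.proj (FreeSMC.sum A) X ⋙ P) ⋙
      (evaluation _ _).obj b).ColimitTypeRel) ⟨CostructuredArrow.mk t, p⟩
        ⟨CostructuredArrow.mk t', p'⟩ := by
  have hc := isColimitSections η X b
  rw [← Quot.eq]
  have h2 := (Types.isColimit_iff_coconeTypesIsColimit _).1 ⟨hc⟩
  apply h2.bijective.1
  exact h

end

variable {G B : Type u} [SmallGroupoid G] [SmallCategory B]
  {F : (Gᵒᵖ ⥤ Type u) ⥤ (Bᵒᵖ ⥤ Type u)} {P : FreeSMC G ⥤ (Bᵒᵖ ⥤ Type u)}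
  (η : P ⟶ FreeSMC.sum G ⋙ F) [F.IsLeftKanExtension η]

theorem exists_hom_of_elem_eq {X : Gᵒᵖ ⥤ Type u} {b : Bᵒᵖ} {a a' : FreeSMC G}
    {t : (FreeSMC.sum G).obj a ⟶ X} {t' : (FreeSMC.sum G).obj a' ⟶ X}
    {p : (P.obj a).obj b} {p' : (P.obj a').obj b} (h : elem η t p = elem η t' p') :
    ∃ f : a ⟶ a', (FreeSMC.sum G).map f ≫ t' = t ∧ (P.map f).app b p = p' := by
  have map_comp_apply {i j k : FreeSMC G} (f : i ⟶ j) (g : j ⟶ k) (q : (P.obj i).obj b) :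
      (P.map (f ≫ g)).app b q = (P.map g).app b ((P.map f).app b q) := by simp
  have map_id_apply {i : FreeSMC G} (q : (P.obj i).obj b) : (P.map (𝟙 i)).app b q = q := by simp
  have key : ∀ x y, Relation.EqvGen (((CostructuredArrow.proj (FreeSMC.sum G) X ⋙ P) ⋙
      (evaluation _ _).obj b).ColimitTypeRel) x y →
      ∃ f : x.1.left ⟶ y.1.left, (FreeSMC.sum G).map f ≫ y.1.hom = x.1.hom ∧
        (P.map f).app b x.2 = y.2 := by
    intro x y hxy
    induction hxy with
    | rel x y h =>
      obtain ⟨f, hf⟩ := h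
      exact ⟨f.left, CostructuredArrow.w f, hf.symm⟩
    | refl x => exact ⟨𝟙 _, by simp, map_id_apply _⟩
    | symm x y _ ih =>
      obtain ⟨f, hf, hp⟩ := ih
      refine ⟨FreeSMC.inv f, ?_, ?_⟩
      · rw [← hf, ← Category.assoc, ← Functor.map_comp, FreeSMC.inv_comp]
        simp
      · rw [← hp]
        refine (map_comp_apply f (FreeSMC.inv f) _).symm.trans ?_
        rw [FreeSMC.comp_inv]
        exact map_id_apply _
    | trans x y z _ _ ih ih' =>
      obtain ⟨f, hf, hp⟩ := ih
      obtain ⟨g, hg, hq⟩ := ih'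
      exact ⟨f ≫ g, by simp [hg, hf], (map_comp_apply f g _).trans (hp ▸ hq)⟩
  exact key _ _ (eqvGen_of_elem_eq η h)

end IsAnalytic

/-- The properties of analytic endofunctors of presheaf categories over groupoids from which the
existence of an initial algebra and of a final coalgebra is deduced. -/
structure HasFiniteSupports {C : Type u} [SmallCategory C]
    (F : (Cᵒᵖ ⥤ Type u) ⥤ (Cᵒᵖ ⥤ Type u)) : Prop where
  injective_map_ι : ∀ {X : Cᵒᵖ ⥤ Type u} (U : Subfunctor X) (b : Cᵒᵖ),
    Function.Injective ((F.map U.ι).app b)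
  mem_range_preimage : ∀ {X Y : Cᵒᵖ ⥤ Type u} (g : X ⟶ Y) (U : Subfunctor Y) (b : Cᵒᵖ)
    (z : (F.obj X).obj b), (F.map g).app b z ∈ Set.range ((F.map U.ι).app b) →
      z ∈ Set.range ((F.map (U.preimage g).ι).app b)
  exists_support : ∀ {X : Cᵒᵖ ⥤ Type u} (b : Cᵒᵖ) (z : (F.obj X).obj b),
    ∃ (n : ℕ) (x : Fin n → Σ c : Cᵒᵖ, X.obj c), ∀ U : Subfunctor X,
      (∀ i, (x i).2 ∈ U.obj (x i).1) → z ∈ Set.range ((F.map U.ι).app b)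

open Opposite IsAnalytic in
theorem IsAnalytic.hasFiniteSupports {G : Type u} [SmallGroupoid G]
    {F : (Gᵒᵖ ⥤ Type u) ⥤ (Gᵒᵖ ⥤ Type u)} (hF : IsAnalytic F) : HasFiniteSupports F := by
  obtain ⟨P, η, hη⟩ := hF
  refine ⟨?_, ?_, ?_⟩
  · intro X U b z z' h
    obtain ⟨a, t, p, rfl⟩ := exists_elem_eq η z
    obtain ⟨a', t', p', rfl⟩ := exists_elem_eq η z'
    rw [map_elem, map_elem] at h
    obtain ⟨f, hf, rfl⟩ := exists_hom_of_elem_eq η h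
    rw [elem_map]
    rw [← Category.assoc, cancel_mono] at hf
    rw [hf]
  · rintro X Y g U b z ⟨w, hw⟩
    obtain ⟨a, t, p, rfl⟩ := exists_elem_eq η z
    obtain ⟨a', t', p', rfl⟩ := exists_elem_eq η w
    rw [map_elem, map_elem] at hw
    obtain ⟨f, hf, -⟩ := exists_hom_of_elem_eq η hw.symm
    have hr : Subfunctor.range t ≤ U.preimage g := by
      rintro c _ ⟨x, rfl⟩
      change g.app c (t.app c x) ∈ U.obj c
      rw [← ConcreteCategory.comp_apply, ← NatTrans.comp_app, ← hf]
      exact (t'.app c (((FreeSMC.sum G).map f).app c x)).2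
    exact ⟨elem η (Subfunctor.lift t hr) p, by rw [map_elem, Subfunctor.lift_ι]⟩
  · intro X b z
    obtain ⟨a, t, p, rfl⟩ := exists_elem_eq η z
    refine ⟨a.card, fun i => ⟨op (a.obj i), t.app (op (a.obj i)) ⟨i, 𝟙 _⟩⟩, fun U hU => ?_⟩
    have hr : Subfunctor.range t ≤ U := by
      rintro c _ ⟨⟨i, k⟩, rfl⟩
      have h := NatTrans.naturality_apply t k.op
        (⟨i, 𝟙 _⟩ : ((FreeSMC.sum G).obj a).obj (op (a.obj i)))
      have h' : ((FreeSMC.sum G).obj a).map k.op ⟨i, 𝟙 _⟩ = ⟨i, k⟩ :=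
        congrArg (Sigma.mk (β := fun i => c.unop ⟶ a.obj i) i) (Category.comp_id k)
      rw [h'] at h
      have := U.map k.op (hU i)
      exact Set.mem_of_eq_of_mem h this
    exact ⟨elem η (Subfunctor.lift t hr) p, by rw [map_elem, Subfunctor.lift_ι]⟩

namespace CategoryTheory.Endofunctor.Coalgebra

open Limits

section

universe v w v' w'

variable {C : Type w} [Category.{v} C] {F : C ⥤ C} {J : Type w'} [Category.{v'} J]
  (D : J ⥤ Coalgebra F)

/-- The structure maps of a diagram of coalgebras, as a cocone on the carriers. -/
@[simps]
def strCocone (c : Cocone (D ⋙ forget F)) : Cocone (D ⋙ forget F) where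
  pt := F.obj c.pt
  ι :=
    { app j := (D.obj j).str ≫ F.map (c.ι.app j)
      naturality i j f := by
        let l : ∀ k, (D.obj k).V ⟶ c.pt := fun k => c.ι.app k
        have hl : (D.map f).f ≫ l j = l i := c.w f
        change (D.map f).f ≫ (D.obj j).str ≫ F.map (l j) =
          ((D.obj i).str ≫ F.map (l i)) ≫ 𝟙 _
        rw [← hl, F.map_comp, Hom.h_assoc, Category.comp_id] }

/-- The coalgebra structure on the colimit of the carriers of a diagram of coalgebras. -/
@[simps]
def coconeOfIsColimit {c : Cocone (D ⋙ forget F)} (hc : IsColimit c) : Cocone D where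
  pt :=
    { V := c.pt
      str := hc.desc (strCocone D c) }
  ι :=
    { app j :=
        { f := c.ι.app j
          h := (hc.fac (strCocone D c) j).symm }
      naturality i j f := by
        ext
        exact c.ι.naturality f }

/-- The colimit of the carriers of a diagram of coalgebras is a colimit of coalgebras. -/
def isColimitCoconeOfIsColimit {c : Cocone (D ⋙ forget F)} (hc : IsColimit c) :
    IsColimit (coconeOfIsColimit D hc) where
  desc s :=
    { f := hc.desc ((forget F).mapCocone s)
      h := hc.hom_ext fun j => by
        let l : (D.obj j).V ⟶ (coconeOfIsColimit D hc).pt.V := c.ι.app j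
        let d : (coconeOfIsColimit D hc).pt.V ⟶ s.pt.V := hc.desc ((forget F).mapCocone s)
        have h₁ : l ≫ (coconeOfIsColimit D hc).pt.str =
          (D.obj j).str ≫ F.map l := hc.fac (strCocone D c) j
        have h₂ : l ≫ d = (s.ι.app j).f := hc.fac ((forget F).mapCocone s) j
        change l ≫ (coconeOfIsColimit D hc).pt.str ≫ F.map d = l ≫ d ≫ s.pt.str
        rw [reassoc_of% h₁, reassoc_of% h₂, ← Functor.map_comp, h₂]
        exact (s.ι.app j).h }
  fac s j := by
    ext
    exact hc.fac ((forget F).mapCocone s) j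
  uniq s m hm := by
    ext
    exact hc.uniq ((forget F).mapCocone s) m.f fun j => congrArg Hom.f (hm j)

instance [HasColimitsOfShape J C] : HasColimitsOfShape J (Coalgebra F) where
  has_colimit D := ⟨⟨_, isColimitCoconeOfIsColimit D (colimit.isColimit _)⟩⟩

instance [HasColimitsOfShape J C] : PreservesColimitsOfShape J (forget F) where
  preservesColimit {D} := preservesColimit_of_preserves_colimit_cocone
    (isColimitCoconeOfIsColimit D (colimit.isColimit _)) (colimit.isColimit _)

end

variable {C : Type u} [SmallCategory C] {F : (Cᵒᵖ ⥤ Type u) ⥤ (Cᵒᵖ ⥤ Type u)}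

instance : HasColimitsOfSize.{u, u} (Coalgebra F) where

theorem surjective_of_epi {X Y : Coalgebra F} (e : X ⟶ Y) [Epi e] (c : Cᵒᵖ) :
    Function.Surjective (e.f.app c) := by
  have : Epi ((forget F).map e) := inferInstance
  have : Epi e.f := this
  exact CategoryTheory.surjective_of_epi (e.f.app c)

theorem exists_comp_eq_of_ker_le {X Y W : Coalgebra F} (e : X ⟶ Y) [Epi e] (f : X ⟶ W)
    (h : ∀ (c : Cᵒᵖ) (x y : X.V.obj c), e.f.app c x = e.f.app c y → f.f.app c x = f.f.app c y) :
    ∃ k : Y ⟶ W, e ≫ k = f := by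
  choose s hs using surjective_of_epi e
  have hk : ∀ (c : Cᵒᵖ) (x : X.V.obj c), f.f.app c (s c (e.f.app c x)) = f.f.app c x :=
    fun c x => h c _ _ (hs c _)
  let k : Y.V ⟶ W.V :=
    { app c := ↾fun y => f.f.app c (s c y)
      naturality c d g := by
        refine ConcreteCategory.hom_ext _ _ fun y => ?_
        obtain ⟨x, rfl⟩ := surjective_of_epi e c y
        change f.f.app d (s d (Y.V.map g (e.f.app c x))) =
          W.V.map g (f.f.app c (s c (e.f.app c x)))
        rw [hk, ← NatTrans.naturality_apply, hk, NatTrans.naturality_apply] }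
  have hek : e.f ≫ k = f.f := by
    refine NatTrans.ext (funext fun c => ConcreteCategory.hom_ext _ _ fun x => ?_)
    exact hk c x
  have : Epi ((forget F).map e) := inferInstance
  have : Epi e.f := this
  refine ⟨⟨k, ?_⟩, Coalgebra.ext hek⟩
  rw [← cancel_epi e.f, ← Hom.h_assoc, ← Functor.map_comp, hek, f.h, reassoc_of% hek]

instance : WellPowered.{u} (Coalgebra F)ᵒᵖ where
  subobject_small X := by
    let φ : Subobject X → ∀ c : Cᵒᵖ, X.unop.V.obj c → X.unop.V.obj c → Prop := fun S c x y =>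
      S.arrow.unop.f.app c x = S.arrow.unop.f.app c y
    have key : ∀ S T : Subobject X, φ S = φ T → T ≤ S := fun S T h => by
      obtain ⟨k, hk⟩ := exists_comp_eq_of_ker_le S.arrow.unop T.arrow.unop fun c x y hxy =>
        (congrFun (congrFun (congrFun h c) x) y).mp hxy
      exact Subobject.le_of_comm k.op (Quiver.Hom.unop_inj hk)
    exact small_of_injective (f := φ) fun S T h => le_antisymm (key T S h.symm) (key S T h)

end CategoryTheory.Endofunctor.Coalgebra

namespace CategoryTheory.Endofunctor.Coalgebra

open Limits

variable {C : Type u} [SmallCategory C] {F : (Cᵒᵖ ⥤ Type u) ⥤ (Cᵒᵖ ⥤ Type u)}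

/-- A subpresheaf of a coalgebra stable under the structure map underlies a subcoalgebra. -/
theorem exists_subcoalgebra (hF : HasFiniteSupports F) (X : Coalgebra F) (U : Subfunctor X.V)
    (hU : ∀ (c : Cᵒᵖ), ∀ x ∈ U.obj c, X.str.app c x ∈ Set.range ((F.map U.ι).app c)) :
    ∃ ξ : U.toFunctor ⟶ F.obj U.toFunctor, ξ ≫ F.map U.ι = U.ι ≫ X.str := by
  choose s hs using hU
  have hs' : ∀ (c : Cᵒᵖ) (x : U.toFunctor.obj c),
    (F.map U.ι).app c (s c x.1 x.2) = X.str.app c x.1 := fun c x => hs c x.1 x.2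
  refine ⟨{ app c := ↾fun x => s c x.1 x.2, naturality c d g := ?_ }, ?_⟩
  · refine ConcreteCategory.hom_ext _ _ fun x => hF.injective_map_ι U d ?_
    change (F.map U.ι).app d (s d (U.toFunctor.map g x).1 (U.toFunctor.map g x).2) =
      (F.map U.ι).app d ((F.obj U.toFunctor).map g (s c x.1 x.2))
    rw [NatTrans.naturality_apply, hs' c x, hs' d]
    exact NatTrans.naturality_apply X.str g x.1
  · refine NatTrans.ext (funext fun c => ConcreteCategory.hom_ext _ _ fun x => ?_)
    exact hs' c x

/-- The alphabet for the words which describe the elements of a coalgebra reachable from a given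
one. -/
abbrev Letter (C : Type u) [SmallCategory C] : Type u :=
  (Σ c d : Cᵒᵖ, c ⟶ d) ⊕ ℕ

section Reachable

variable {V : Cᵒᵖ ⥤ Type u} {n : (Σ c : Cᵒᵖ, V.obj c) → ℕ}
  (gen : ∀ e : Σ c : Cᵒᵖ, V.obj c, Fin (n e) → Σ c : Cᵒᵖ, V.obj c)

open Classical in
/-- The action of a letter on the elements of a presheaf equipped with a choice of finitely many
successors of each element: restriction along a morphism, or passage to a successor. -/
noncomputable def step : Letter C → (Σ c : Cᵒᵖ, V.obj c) → Σ c : Cᵒᵖ, V.obj c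
  | .inl ⟨c, d, g⟩, e => if h : e.1 = c then ⟨d, V.map (eqToHom h ≫ g) e.2⟩ else e
  | .inr i, e => if h : i < n e then gen e ⟨i, h⟩ else e

/-- The subpresheaf of the elements reachable from `e`. -/
def reachable (e : Σ c : Cᵒᵖ, V.obj c) : Subfunctor V where
  obj c := {x | ∃ l : List (Letter C), l.foldr (step gen) e = ⟨c, x⟩}
  map {c d} g := by
    rintro x ⟨l, hl⟩
    refine ⟨.inl ⟨c, d, g⟩ :: l, ?_⟩
    rw [List.foldr_cons, hl]
    simp [step]

theorem gen_mem_reachable (e : Σ c : Cᵒᵖ, V.obj c) {c : Cᵒᵖ} {x : V.obj c}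
    (hx : x ∈ (reachable gen e).obj c) (i : Fin (n ⟨c, x⟩)) :
    (gen ⟨c, x⟩ i).2 ∈ (reachable gen e).obj (gen ⟨c, x⟩ i).1 := by
  obtain ⟨l, hl⟩ := hx
  refine ⟨.inr i :: l, ?_⟩
  rw [List.foldr_cons, hl]
  simp [step]

theorem exists_injective_reachable (e : Σ c : Cᵒᵖ, V.obj c) (c : Cᵒᵖ) :
    ∃ f : (reachable gen e).toFunctor.obj c → List (Letter C), Function.Injective f := by
  choose f hf using fun x : (reachable gen e).toFunctor.obj c => x.2
  exact ⟨f, fun x y h => Subtype.ext (eq_of_heq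
    (Sigma.mk.inj ((hf x).symm.trans (h ▸ hf y))).2)⟩

end Reachable

/-- The essentially small category of types which embed into a given type. -/
abbrev SubType (K : Type u) : Type u :=
  InducedCategory (Type u) fun s : Set K => (s : Type u)

/-- A presheaf with values embedding into `K`, seen as an ordinary presheaf. -/
abbrev ofCode {K : Type u} (D : Cᵒᵖ ⥤ SubType K) : Cᵒᵖ ⥤ Type u :=
  D ⋙ inducedFunctor _

theorem exists_iso_ofCode {K : Type u} (V : Cᵒᵖ ⥤ Type u)
    (hV : ∀ c, ∃ f : V.obj c → K, Function.Injective f) :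
    ∃ D : Cᵒᵖ ⥤ SubType K, Nonempty (ofCode D ≅ V) := by
  choose f hf using hV
  let e : ∀ c, (Set.range (f c) : Type u) ≅ V.obj c := fun c =>
    (Equiv.ofInjective (f c) (hf c)).symm.toIso
  let D : Cᵒᵖ ⥤ SubType K :=
    { obj c := Set.range (f c)
      map g := InducedCategory.homMk ((e _).hom ≫ V.map g ≫ (e _).inv)
      map_id c := by
        refine InducedCategory.hom_ext ?_
        change (e c).hom ≫ V.map (𝟙 c) ≫ (e c).inv = 𝟙 _
        simp
      map_comp {c d d'} g h := by
        refine InducedCategory.hom_ext ?_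
        change (e c).hom ≫ V.map (g ≫ h) ≫ (e d').inv =
          ((e c).hom ≫ V.map g ≫ (e d).inv) ≫ (e d).hom ≫ V.map h ≫ (e d').inv
        simp }
  refine ⟨D, ⟨NatIso.ofComponents e fun {c d} g => ?_⟩⟩
  change ((e c).hom ≫ V.map g ≫ (e d).inv) ≫ (e d).hom = (e c).hom ≫ V.map g
  simp

/-- The coalgebras whose carrier takes values in subtypes of the type of words. -/
abbrev codeCoalgebra (F : (Cᵒᵖ ⥤ Type u) ⥤ (Cᵒᵖ ⥤ Type u)) :
    (Σ D : Cᵒᵖ ⥤ SubType (List (Letter C)), ofCode D ⟶ F.obj (ofCode D)) → Coalgebra F :=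
  fun D => ⟨ofCode D.1, D.2⟩

theorem isSeparating_codeCoalgebra (hF : HasFiniteSupports F) :
    (ObjectProperty.ofObj (codeCoalgebra F)).IsSeparating := by
  intro X Y f g hfg
  refine Coalgebra.ext (NatTrans.ext (funext fun c => ConcreteCategory.hom_ext _ _ fun x => ?_))
  choose n gen hgen using fun e : Σ c : Cᵒᵖ, X.V.obj c => hF.exists_support e.1 (X.str.app e.1 e.2)
  let U := reachable gen ⟨c, x⟩
  obtain ⟨ξ, hξ⟩ := exists_subcoalgebra hF X U fun d y hy =>
    hgen ⟨d, y⟩ U fun i => gen_mem_reachable gen _ hy i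
  obtain ⟨D, ⟨α⟩⟩ := exists_iso_ofCode U.toFunctor (exists_injective_reachable gen ⟨c, x⟩)
  let j : codeCoalgebra F ⟨D, α.hom ≫ ξ ≫ F.map α.inv⟩ ⟶ X :=
    { f := α.hom ≫ U.ι
      h := by
        change (α.hom ≫ ξ ≫ F.map α.inv) ≫ F.map (α.hom ≫ U.ι) = (α.hom ≫ U.ι) ≫ X.str
        simp only [Category.assoc, ← Functor.map_comp, Iso.inv_hom_id_assoc, hξ] }
  have h := congrArg (fun k => α.inv ≫ Hom.f k) (hfg _ (ObjectProperty.ofObj_apply _ _) j)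
  have h' : U.ι ≫ f.f = U.ι ≫ g.f := by simpa [j] using h
  exact ConcreteCategory.congr_hom (NatTrans.congr_app h' c)
    (⟨x, [], rfl⟩ : U.toFunctor.obj c)

theorem hasTerminal (hF : HasFiniteSupports F) : HasTerminal (Coalgebra F) :=
  hasTerminal_of_isSeparating.{u} (isSeparating_codeCoalgebra hF)

end CategoryTheory.Endofunctor.Coalgebra

namespace CategoryTheory.Endofunctor.Algebra

open Limits

variable {C : Type u} [SmallCategory C] {F : (Cᵒᵖ ⥤ Type u) ⥤ (Cᵒᵖ ⥤ Type u)}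

/-- A subpresheaf of the carrier of an algebra is a subalgebra if it is stable under the structure
map. -/
def IsSubalgebra (A : Algebra F) (U : Subfunctor A.a) : Prop :=
  ∀ (b : Cᵒᵖ) (w : (F.obj U.toFunctor).obj b), A.str.app b ((F.map U.ι).app b w) ∈ U.obj b

/-- The least subalgebra of an algebra, as a subpresheaf. -/
def least (A : Algebra F) : Subfunctor A.a :=
  sInf {U | IsSubalgebra A U}

variable {A : Algebra F}

theorem least_le {U : Subfunctor A.a} (hU : IsSubalgebra A U) : least A ≤ U :=
  sInf_le hU

theorem map_comp_app {X Y Z : Cᵒᵖ ⥤ Type u} (f : X ⟶ Y) (g : Y ⟶ Z) (b : Cᵒᵖ)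
    (w : (F.obj X).obj b) :
    (F.map (f ≫ g)).app b w = (F.map g).app b ((F.map f).app b w) := by
  simp

theorem map_ι_app_eq {X : Cᵒᵖ ⥤ Type u} {U V : Subfunctor X} (h : U ≤ V) (b : Cᵒᵖ)
    (w : (F.obj U.toFunctor).obj b) :
    (F.map V.ι).app b ((F.map (Subfunctor.homOfLe h)).app b w) = (F.map U.ι).app b w := by
  rw [← map_comp_app, Subfunctor.homOfLe_ι]

theorem isSubalgebra_least (A : Algebra F) : IsSubalgebra A (least A) := by
  intro b w
  rintro _ ⟨U, hU, rfl⟩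
  change _ ∈ U.obj b
  rw [← map_ι_app_eq (least_le hU)]
  exact hU _ _

theorem range_str_le (A : Algebra F) :
    Subfunctor.range (F.map (least A).ι ≫ A.str) ≤ least A := by
  rintro b _ ⟨w, rfl⟩
  exact isSubalgebra_least A b w

/-- The least subalgebra of an algebra. -/
@[simps]
def leastAlgebra (A : Algebra F) : Algebra F where
  a := (least A).toFunctor
  str := Subfunctor.lift (F.map (least A).ι ≫ A.str) (range_str_le A)

theorem exists_str_eq_of_mem_least {b : Cᵒᵖ} {z : A.a.obj b} (hz : z ∈ (least A).obj b) :
    ∃ w, A.str.app b ((F.map (least A).ι).app b w) = z := by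
  refine least_le (U := Subfunctor.range (F.map (least A).ι ≫ A.str)) ?_ b hz
  intro b w
  exact ⟨(F.map (Subfunctor.homOfLe (range_str_le A))).app b w,
    congrArg (A.str.app b) (map_ι_app_eq (range_str_le A) b w)⟩

theorem hom_ext_leastAlgebra {B : Algebra F} (f g : leastAlgebra A ⟶ B) : f = g := by
  let E : Subfunctor A.a :=
    { obj b := {z | ∃ h : z ∈ (least A).obj b, f.f.app b ⟨z, h⟩ = g.f.app b ⟨z, h⟩}
      map {b c} k := by
        rintro z ⟨h, e⟩
        refine ⟨(least A).map k h, ?_⟩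
        have hf := NatTrans.naturality_apply f.f k (⟨z, h⟩ : (least A).toFunctor.obj b)
        have hg := NatTrans.naturality_apply g.f k (⟨z, h⟩ : (least A).toFunctor.obj b)
        exact hf.trans ((congrArg (B.a.map k) e).trans hg.symm) }
  have hE : E ≤ least A := fun b z hz => hz.1
  have hfg : Subfunctor.homOfLe hE ≫ f.f = Subfunctor.homOfLe hE ≫ g.f :=
    NatTrans.ext (funext fun b => ConcreteCategory.hom_ext _ _ fun z => z.2.2)
  have hstr : ∀ (k : leastAlgebra A ⟶ B) (b : Cᵒᵖ) (w : (F.obj E.toFunctor).obj b)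
      (h : A.str.app b ((F.map E.ι).app b w) ∈ (least A).obj b),
      k.f.app b ⟨_, h⟩ = B.str.app b ((F.map (Subfunctor.homOfLe hE ≫ k.f)).app b w) := by
    intro k b w h
    have := ConcreteCategory.congr_hom (NatTrans.congr_app k.h b)
      ((F.map (Subfunctor.homOfLe hE)).app b w)
    refine (congrArg (k.f.app b) (Subtype.ext ?_)).trans
      (this.symm.trans (congrArg (B.str.app b) (map_comp_app _ k.f b w).symm))
    exact congrArg (A.str.app b) (map_ι_app_eq hE b w).symm
  have hsub : IsSubalgebra A E := by
    intro b w
    have hmem : A.str.app b ((F.map E.ι).app b w) ∈ (least A).obj b := by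
      rw [← map_ι_app_eq hE]
      exact isSubalgebra_least A b _
    exact ⟨hmem, by rw [hstr f, hstr g, hfg]⟩
  refine Algebra.ext (NatTrans.ext (funext fun b => ConcreteCategory.hom_ext _ _ fun z => ?_))
  exact (least_le hsub b z.2).2

/-- The product of two algebras. -/
@[simps]
def prod (A B : Algebra F) : Algebra F where
  a := FunctorToTypes.prod A.a B.a
  str := FunctorToTypes.prod.lift (F.map FunctorToTypes.prod.fst ≫ A.str)
    (F.map FunctorToTypes.prod.snd ≫ B.str)

theorem nonempty_hom_leastAlgebra (hF : HasFiniteSupports F) [IsIso A.str] (B : Algebra F) :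
    Nonempty (leastAlgebra A ⟶ B) := by
  let R := least (prod A B)
  let V : Subfunctor A.a :=
    { obj b := {z | ∀ (c : Cᵒᵖ) (k : b ⟶ c), ∃! y : B.a.obj c, (A.a.map k z, y) ∈ R.obj c}
      map {b c} k z hz d l := by
        simpa using hz d (k ≫ l) }
  have hV : ∀ (b : Cᵒᵖ) (z : V.toFunctor.obj b), ∃! y : B.a.obj b, (z.1, y) ∈ R.obj b :=
    fun b z => by simpa using z.2 b (𝟙 b)
  choose s hs hs' using hV
  let σ : V.toFunctor ⟶ R.toFunctor :=
    { app b := ↾fun z => ⟨(z.1, s b z), hs b z⟩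
      naturality b c k := by
        refine ConcreteCategory.hom_ext _ _ fun z => Subtype.ext (Prod.ext ?_ ?_)
        · rfl
        exact (hs' c (V.toFunctor.map k z) _ (R.map k (hs b z))).symm }
  let π : R.toFunctor ⟶ A.a := R.ι ≫ FunctorToTypes.prod.fst
  let τ : R.toFunctor ⟶ B.a := R.ι ≫ FunctorToTypes.prod.snd
  have hσπ : σ ≫ π = V.ι := rfl
  have hstr : ∀ (b : Cᵒᵖ) (r : (F.obj R.toFunctor).obj b),
      (prod A B).str.app b ((F.map R.ι).app b r) =
        (A.str.app b ((F.map π).app b r), B.str.app b ((F.map τ).app b r)) := by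
    intro b r
    exact Prod.ext (congrArg (A.str.app b) (map_comp_app R.ι FunctorToTypes.prod.fst b r).symm)
      (congrArg (B.str.app b) (map_comp_app R.ι FunctorToTypes.prod.snd b r).symm)
  have hinj : ∀ b, Function.Injective (A.str.app b) := fun b =>
    ((isIso_iff_bijective (A.str.app b)).1 inferInstance).1
  have hσ : ∀ (b : Cᵒᵖ) (w : (F.obj V.toFunctor).obj b),
      (F.map π).app b ((F.map σ).app b w) = (F.map V.ι).app b w := fun b w => by
    rw [← map_comp_app, hσπ]
  have hmem : ∀ (b : Cᵒᵖ) (w : (F.obj V.toFunctor).obj b),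
      (A.str.app b ((F.map V.ι).app b w), B.str.app b ((F.map τ).app b ((F.map σ).app b w))) ∈
        R.obj b := fun b w => by
    rw [← hσ, ← hstr]
    exact isSubalgebra_least _ _ _
  have huniq : ∀ (b : Cᵒᵖ) (w : (F.obj V.toFunctor).obj b) (y : B.a.obj b),
      (A.str.app b ((F.map V.ι).app b w), y) ∈ R.obj b →
        y = B.str.app b ((F.map τ).app b ((F.map σ).app b w)) := by
    intro b w y hy
    obtain ⟨r, hr⟩ := exists_str_eq_of_mem_least (A := prod A B) hy
    rw [hstr] at hr
    have h₁ : (F.map π).app b r = (F.map V.ι).app b w :=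
      hinj b (congrArg (fun q : A.a.obj b × B.a.obj b => q.1) hr)
    have h₂ : B.str.app b ((F.map τ).app b r) = y :=
      congrArg (fun q : A.a.obj b × B.a.obj b => q.2) hr
    obtain ⟨q, rfl⟩ := hF.mem_range_preimage π V b r ⟨w, h₁.symm⟩
    have hfac : (V.preimage π).ι = V.fromPreimage π ≫ σ := by
      refine NatTrans.ext (funext fun c => ConcreteCategory.hom_ext _ _ fun x => ?_)
      exact Subtype.ext (Prod.ext rfl (hs' c ⟨_, x.2⟩ _ x.1.2))
    rw [hfac, map_comp_app] at h₁ h₂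
    rw [hσ] at h₁
    rw [hF.injective_map_ι V b h₁] at h₂
    exact h₂.symm
  have hsub : IsSubalgebra A V := by
    intro b w c k
    rw [← NatTrans.naturality_apply, ← NatTrans.naturality_apply]
    exact ⟨_, hmem c _, huniq c _⟩
  have hle := least_le hsub
  refine ⟨⟨Subfunctor.homOfLe hle ≫ σ ≫ τ, ?_⟩⟩
  refine NatTrans.ext (funext fun b => ConcreteCategory.hom_ext _ _ fun w => ?_)
  let w' : (F.obj V.toFunctor).obj b := (F.map (Subfunctor.homOfLe hle)).app b w
  have h := hs' b ⟨A.str.app b ((F.map V.ι).app b w'), hsub b w'⟩ _ (hmem b w')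
  refine (congrArg (B.str.app b) ?_).trans (h.trans (congrArg (s b) (Subtype.ext ?_)))
  · exact (map_comp_app (Subfunctor.homOfLe hle) (σ ≫ τ) b w).trans (map_comp_app σ τ b w')
  · exact congrArg (A.str.app b) (map_ι_app_eq hle b w)

theorem hasInitial (hF : HasFiniteSupports F) : HasInitial (Algebra F) := by
  have := Coalgebra.hasTerminal hF
  let T : Coalgebra F := ⊤_ _
  have : IsIso T.str := Coalgebra.Terminal.str_isIso terminalIsTerminal
  let A : Algebra F := ⟨T.V, CategoryTheory.inv T.str⟩
  have : IsIso A.str := inferInstanceAs (IsIso (CategoryTheory.inv T.str))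
  have (B : Algebra F) : Nonempty (leastAlgebra A ⟶ B) := nonempty_hom_leastAlgebra hF B
  have (B : Algebra F) : Subsingleton (leastAlgebra A ⟶ B) := ⟨hom_ext_leastAlgebra⟩
  exact hasInitial_of_unique (leastAlgebra A)

end CategoryTheory.Endofunctor.Algebra

theorem mainTheorem9 {G : Type u} [SmallGroupoid G]
    (F : (Gᵒᵖ ⥤ Type u) ⥤ (Gᵒᵖ ⥤ Type u)) (hF : IsAnalytic F) :
    Limits.HasInitial (Endofunctor.Algebra F) ∧
      Limits.HasTerminal (Endofunctor.Coalgebra F) :=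
  ⟨Endofunctor.Algebra.hasInitial hF.hasFiniteSupports,
    Endofunctor.Coalgebra.hasTerminal hF.hasFiniteSupports⟩
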